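/- Theorem 1. Let $A\in\mathbb R^{m\times m}$, let $B\in\mathbb R^{m\times 1}$ be a column and $C\in\mathbb R^{1\times m}$ a row, let $\psi\in\mathbb R$, and let $T>0$, $\sigma_1>0$, $\sigma_*>0$. Consider on $[0,\infty)$ the closed-loop pulse-width modulated system $$\frac{dx}{dt}=Ax+Bf,\qquad \sigma=Cx+\psi,\qquad f=M\sigma, \tag{17a}$$ where the modulator $M$ is defined as follows: for $n=0,1,2,\dots$, $f(t)=1$ for $nT\le t<nT+\tau_n$ and $f(t)=0$ for $nT+\tau_n\le t<(n+1)T$, where $\tau_n=0$ if $\sigma(nT)\le\sigma_1$; $\tau_n=T$ if $\sigma(nT+\tau)>\sigma_1+\sigma_*\tau/T$ for all $\tau\in[0,T]$; and in all other cases $\tau_n$ is the smallest $\tau\in[0,T]$ with $\sigma(nT+\tau)=\sigma_1+\sigma_*\tau/T$. (A solution is a continuous $x$ that satisfies the differential equation at all times $t>0$ at which $f$ does not switch.) Suppose that $A$ is Hurwitz stable (all its eigenvalues have negative real parts) and that $$\sigma_1<\psi<\sigma_1+\sigma_*+CA^{-1}B .$$ Let $\gamma=\sigma_*/T-\min\{0,CB\}$,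 and suppose that there exist a number $\varepsilon>0$ and a symmetric matrix $P\in\mathbb R^{m\times m}$ with $$P(A^\top+\varepsilon I)+(A+\varepsilon I)P\preceq-\frac1{2\varepsilon}BB^\top,\qquad P\succ0,\qquad CAPA^\top C^\top<\gamma^2 ,$$ where $\succ 0$ means positive definite, and $X\preceq Y$ means that $Y-X$ is positive semidefinite. Then (17a) has an unsaturated $T$-periodic mode, that is, a solution with $x(t+T)=x(t)$ and $f(t+T)=f(t)$ for all $t\ge0$, for which $f$ is neither identically $0$ nor identically $1$ on $[0,\infty)$. -/

import Mathlib

open Matrix Set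

namespace PWM

/-- A real square matrix is Hurwitz stable: all its (complex) eigenvalues have negative
real parts. -/
def IsHurwitz {m : ℕ} (A : Matrix (Fin m) (Fin m) ℝ) : Prop :=
  ∀ z : ℂ, Module.End.HasEigenvalue (Matrix.toLin' (A.map Complex.ofReal)) z → z.re < 0

/-- The ramp inside one switching period, at local time `s ∈ [0, T]`. -/
noncomputable def ramp (T σ₁ σs s : ℝ) : ℝ := σ₁ + σs * s / T

/-- `τ` is the pulse width prescribed in the `n`-th switching period by natural pulse-width
modulation with a latch, for the modulator input `σ`. -/
def IsPulseWidth (T σ₁ σs : ℝ) (σ : ℝ → ℝ) (n : ℕ) (τ : ℝ) : Prop :=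
  (σ (n * T) ≤ σ₁ ∧ τ = 0) ∨
  ((∀ s ∈ Icc 0 T, ramp T σ₁ σs s < σ (n * T + s)) ∧ τ = T) ∨
  (¬ σ (n * T) ≤ σ₁ ∧ ¬ (∀ s ∈ Icc 0 T, ramp T σ₁ σs s < σ (n * T + s)) ∧
    IsLeast {s | s ∈ Icc 0 T ∧ σ (n * T + s) = ramp T σ₁ σs s} τ)

/-- `f = M σ` on `[0, ∞)`: in the `n`-th period `f` is a unit pulse whose width is the one
prescribed by the modulation law for the input `σ`. -/
def IsModulatorOutput (T σ₁ σs : ℝ) (σ f : ℝ → ℝ) : Prop :=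
  ∃ τ : ℕ → ℝ, ∀ n : ℕ, IsPulseWidth T σ₁ σs σ n (τ n) ∧
    (∀ t, n * T ≤ t → t < n * T + τ n → f t = 1) ∧
    (∀ t, n * T + τ n ≤ t → t < (n + 1) * T → f t = 0)

/-- `(x, f)` is a solution on `[0, ∞)` of the closed loop
`dx/dt = A x + B f`, `σ = C x + ψ`, `f = M σ`.
The input `f` is piecewise constant, so a solution is a continuous `x` that satisfies the
differential equation at every instant at which `f` does not switch. -/
structure IsSolution {m : ℕ} (A : Matrix (Fin m) (Fin m) ℝ) (B C : Fin m → ℝ)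
    (ψ T σ₁ σs : ℝ) (x : ℝ → Fin m → ℝ) (f : ℝ → ℝ) : Prop where
  continuousOn : ContinuousOn x (Ici 0)
  hasDerivAt : ∀ t, 0 < t → ContinuousAt f t → HasDerivAt x (A *ᵥ x t + f t • B) t
  modulator : IsModulatorOutput T σ₁ σs (fun t => C ⬝ᵥ x t + ψ) f

/-- `(x, f)` is an unsaturated `T`-periodic mode of the closed loop: a `T`-periodic solution
for which `f` is neither identically `0` nor identically `1` on `[0, ∞)`. -/
structure IsUnsaturatedPeriodicMode {m : ℕ} (A : Matrix (Fin m) (Fin m) ℝ) (B C : Fin m → ℝ)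
    (ψ T σ₁ σs : ℝ) (x : ℝ → Fin m → ℝ) (f : ℝ → ℝ) : Prop where
  isSolution : IsSolution A B C ψ T σ₁ σs x f
  periodic_state : ∀ t, 0 ≤ t → x (t + T) = x t
  periodic_input : ∀ t, 0 ≤ t → f (t + T) = f t
  not_zero : ¬ ∀ t, 0 ≤ t → f t = 0
  not_one : ¬ ∀ t, 0 ≤ t → f t = 1

end PWM

/-! Pulses of width τ drive the linear part to a T-periodic response. Let G(τ) be σ minus the ramp
at the end of its pulse. The bounds on ψ give G(0) > 0 > G(T), so G vanishes at some τ in (0, T). It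
remains to see that τ is the first crossing. With w = A⁻¹B, the shift z = x + w/2 turns the inputs 0
and 1 into ∓1/2. The matrix inequality makes V(z) = zᵀP⁻¹z satisfy V' ≤ -2ε(V - 1/4), so the
periodic response stays in V ≤ 1/4 (`quadratic_flow_pulseStart_le`). There CAz < γ/2 by
Cauchy–Schwarz (`sq_dotProduct_le`), so σ minus the ramp strictly decreases during the pulse. -/

namespace PWM

/-! ### Lyapunov estimates for the form of P⁻¹. -/

section Lyapunov

variable {m : ℕ} {A P Q : Matrix (Fin m) (Fin m) ℝ} {B : Fin m → ℝ} {ε : ℝ}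

theorem dotProduct_mulVec_symm (hP : Pᵀ = P) (x y : Fin m → ℝ) :
    x ⬝ᵥ (P *ᵥ y) = y ⬝ᵥ (P *ᵥ x) := by
  rw [dotProduct_mulVec, ← mulVec_transpose, hP, dotProduct_comm]

/-- The matrix inequality, read as an inequality between quadratic forms. -/
theorem quadratic_le_of_posSemidef (hP : Pᵀ = P)
    (h : (-(1 / (2 * ε)) • vecMulVec B B
        - (P * (Aᵀ + ε • (1 : Matrix (Fin m) (Fin m) ℝ))
          + (A + ε • (1 : Matrix (Fin m) (Fin m) ℝ)) * P)).PosSemidef) (y : Fin m → ℝ) :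
    2 * (y ⬝ᵥ (A *ᵥ (P *ᵥ y))) + 2 * ε * (y ⬝ᵥ (P *ᵥ y)) + 1 / (2 * ε) * (B ⬝ᵥ y) ^ 2 ≤ 0 := by
  have h1 := h.dotProduct_mulVec_nonneg y
  have h2 : y ⬝ᵥ (P *ᵥ (Aᵀ *ᵥ y)) = y ⬝ᵥ (A *ᵥ (P *ᵥ y)) := by
    rw [dotProduct_mulVec_symm hP, dotProduct_comm, dotProduct_mulVec, ← mulVec_transpose,
      transpose_transpose, dotProduct_comm]
  simp only [star_trivial, sub_mulVec, add_mulVec, mul_add, add_mul, smul_mulVec,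
    dotProduct_sub, dotProduct_add, dotProduct_smul, vecMulVec_mulVec, smul_eq_mul,
    ← mulVec_mulVec, Matrix.mul_smul, Matrix.smul_mul, mul_one, one_mul, h2] at h1
  simp only [op_smul_eq_smul, smul_eq_mul, dotProduct_comm y B] at h1
  nlinarith

/-- Cauchy–Schwarz for the dual pair of quadratic forms of `P` and `P⁻¹`. -/
theorem sq_dotProduct_le (hP : P.PosDef) (hPQ : P * Q = 1) (d z : Fin m → ℝ) :
    (d ⬝ᵥ z) ^ 2 ≤ (d ⬝ᵥ (P *ᵥ d)) * (z ⬝ᵥ (Q *ᵥ z)) := by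
  have hPt : Pᵀ = P := by simpa using hP.isHermitian.eq
  obtain ⟨y, rfl⟩ : ∃ y, z = P *ᵥ y := ⟨Q *ᵥ z, by simp [hPQ]⟩
  have hQP : Q * P = 1 := mul_eq_one_comm.mp hPQ
  have key : ∀ r : ℝ, 0 ≤ (d ⬝ᵥ (P *ᵥ d)) * (r * r) + (2 * (d ⬝ᵥ (P *ᵥ y))) * r
      + y ⬝ᵥ (P *ᵥ y) := by
    intro r
    have h := hP.posSemidef.dotProduct_mulVec_nonneg (r • d + y)
    simp only [star_trivial, mulVec_add, mulVec_smul, dotProduct_add, add_dotProduct,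
      smul_dotProduct, dotProduct_smul, smul_eq_mul, dotProduct_mulVec_symm hPt y d] at h
    linarith
  have h := discrim_le_zero key
  rw [discrim] at h
  rw [mulVec_mulVec, hQP, one_mulVec, dotProduct_comm (P *ᵥ y) y]
  nlinarith

theorem hasDerivAt_quadratic (hQ : Qᵀ = Q) {z : ℝ → Fin m → ℝ} {v : Fin m → ℝ} {t : ℝ}
    (hz : HasDerivAt z v t) :
    HasDerivAt (fun t => z t ⬝ᵥ (Q *ᵥ z t)) (2 * (v ⬝ᵥ (Q *ᵥ z t))) t := by
  have hQz : HasDerivAt (fun t => Q *ᵥ z t) (Q *ᵥ v) t :=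
    (Q.mulVecLin.toContinuousLinearMap.hasFDerivAt.comp_hasDerivAt t hz)
  have h : HasDerivAt (fun t => ∑ i, z t i * (Q *ᵥ z t) i)
      (∑ i, (v i * (Q *ᵥ z t) i + z t i * (Q *ᵥ v) i)) t :=
    HasDerivAt.fun_sum fun i _ => (hasDerivAt_pi.mp hz i).mul (hasDerivAt_pi.mp hQz i)
  convert! h using 1
  rw [Finset.sum_add_distrib, two_mul]
  exact congrArg _ (dotProduct_mulVec_symm hQ v (z t))

/-- Put y = Qz in the matrix inequality and absorb the cross term 2u(B·y) by completing the square.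
-/
theorem quadratic_drift_le (hε : 0 < ε) (hPQ : P * Q = 1)
    (h : ∀ y : Fin m → ℝ, 2 * (y ⬝ᵥ (A *ᵥ (P *ᵥ y))) + 2 * ε * (y ⬝ᵥ (P *ᵥ y))
      + 1 / (2 * ε) * (B ⬝ᵥ y) ^ 2 ≤ 0) (u : ℝ) (z : Fin m → ℝ) :
    2 * ((A *ᵥ z + u • B) ⬝ᵥ (Q *ᵥ z)) ≤ -(2 * ε) * (z ⬝ᵥ (Q *ᵥ z) - u ^ 2) := by
  have h1 := h (Q *ᵥ z)
  rw [mulVec_mulVec z P Q, hPQ, one_mulVec] at h1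
  have h2 : 2 * u * (B ⬝ᵥ (Q *ᵥ z)) ≤ 1 / (2 * ε) * (B ⬝ᵥ (Q *ᵥ z)) ^ 2 + 2 * ε * u ^ 2 := by
    have h3 : 1 / (2 * ε) * (B ⬝ᵥ (Q *ᵥ z)) ^ 2 + 2 * ε * u ^ 2 - 2 * u * (B ⬝ᵥ (Q *ᵥ z))
        = 1 / (2 * ε) * (B ⬝ᵥ (Q *ᵥ z) - 2 * ε * u) ^ 2 := by
      field_simp; ring
    have : 0 ≤ 1 / (2 * ε) * (B ⬝ᵥ (Q *ᵥ z) - 2 * ε * u) ^ 2 := by positivity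
    linarith
  rw [add_dotProduct, smul_dotProduct, smul_eq_mul, dotProduct_comm (A *ᵥ z)]
  rw [dotProduct_comm (Q *ᵥ z) z] at h1
  linarith

/-- The excess of the quadratic form of `P⁻¹` over the squared input decays at rate `2 ε`. -/
theorem antitone_exp_mul_quadratic (hε : 0 < ε) (hQ : Qᵀ = Q) (hPQ : P * Q = 1)
    (h : ∀ y : Fin m → ℝ, 2 * (y ⬝ᵥ (A *ᵥ (P *ᵥ y))) + 2 * ε * (y ⬝ᵥ (P *ᵥ y))
      + 1 / (2 * ε) * (B ⬝ᵥ y) ^ 2 ≤ 0) {u : ℝ} {z : ℝ → Fin m → ℝ}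
    (hz : ∀ t, HasDerivAt z (A *ᵥ z t + u • B) t) :
    Antitone fun t => Real.exp (2 * ε * t) * (z t ⬝ᵥ (Q *ᵥ z t) - u ^ 2) := by
  have hd : ∀ t, HasDerivAt (fun t => Real.exp (2 * ε * t) * (z t ⬝ᵥ (Q *ᵥ z t) - u ^ 2))
      (Real.exp (2 * ε * t) * (2 * ε) * (z t ⬝ᵥ (Q *ᵥ z t) - u ^ 2)
        + Real.exp (2 * ε * t) * (2 * ((A *ᵥ z t + u • B) ⬝ᵥ (Q *ᵥ z t)))) t := fun t =>
    ((((hasDerivAt_id t).const_mul (2 * ε)).congr_deriv (mul_one _)).exp).mul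
      ((hasDerivAt_quadratic hQ (hz t)).sub_const _)
  refine antitone_of_deriv_nonpos (fun t => (hd t).differentiableAt) fun t => ?_
  rw [(hd t).deriv, mul_assoc, ← mul_add]
  exact mul_nonpos_of_nonneg_of_nonpos (Real.exp_pos _).le
    (by linarith [quadratic_drift_le hε hPQ h u (z t)])

theorem eq_zero_of_quadratic_nonpos (hQ : Q.PosDef) {z : Fin m → ℝ}
    (h : z ⬝ᵥ (Q *ᵥ z) ≤ 0) : z = 0 := by
  by_contra hz
  have := hQ.dotProduct_mulVec_pos hz
  simp only [star_trivial] at this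
  linarith

end Lyapunov

/-! ### Trajectories under constant input and the steady pulse response. -/

section Flow

variable {m : ℕ} {A P Q : Matrix (Fin m) (Fin m) ℝ} {B : Fin m → ℝ} {ε : ℝ}

open scoped Matrix.Norms.Operator in
theorem hasDerivAt_exp_smul_mulVec (A : Matrix (Fin m) (Fin m) ℝ) (v : Fin m → ℝ) (t : ℝ) :
    HasDerivAt (fun t : ℝ => NormedSpace.exp (t • A) *ᵥ v)
      (A *ᵥ (NormedSpace.exp (t • A) *ᵥ v)) t := by
  have h := hasDerivAt_exp_smul_const' (𝕂 := ℝ) A t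
  have := (((Matrix.mulVecBilin ℝ ℝ).flip v).toContinuousLinearMap.hasFDerivAt.comp_hasDerivAt t h)
  convert! this using 1
  rw [mulVec_mulVec]
  rfl

theorem exp_add_smul (A : Matrix (Fin m) (Fin m) ℝ) (s t : ℝ) :
    NormedSpace.exp ((s + t) • A) = NormedSpace.exp (s • A) * NormedSpace.exp (t • A) := by
  rw [add_smul]
  exact Matrix.exp_add_of_commute _ _ (((Commute.refl A).smul_left s).smul_right t)

open scoped Matrix.Norms.Operator in
theorem continuous_exp_smul (A : Matrix (Fin m) (Fin m) ℝ) :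
    Continuous fun t : ℝ => NormedSpace.exp (t • A) :=
  continuous_iff_continuousAt.2 fun t =>
    (hasDerivAt_exp_smul_const' (𝕂 := ℝ) A t).continuousAt

/-- The solution of `dx/dt = A x + u A w` that starts at `x₀`. -/
noncomputable def flow (A : Matrix (Fin m) (Fin m) ℝ) (w : Fin m → ℝ) (u : ℝ) (x₀ : Fin m → ℝ)
    (t : ℝ) : Fin m → ℝ :=
  NormedSpace.exp (t • A) *ᵥ (x₀ + u • w) - u • w

theorem flow_zero (w : Fin m → ℝ) (u : ℝ) (x₀ : Fin m → ℝ) : flow A w u x₀ 0 = x₀ := by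
  simp [flow]

theorem hasDerivAt_flow (w : Fin m → ℝ) (u : ℝ) (x₀ : Fin m → ℝ) (t : ℝ) :
    HasDerivAt (flow A w u x₀) (A *ᵥ flow A w u x₀ t + u • (A *ᵥ w)) t := by
  convert! (hasDerivAt_exp_smul_mulVec A (x₀ + u • w) t).sub_const (u • w) using 1
  simp [flow, mulVec_sub, mulVec_smul]

theorem isUnit_det_of_forall_mulVec_eq_zero {M : Matrix (Fin m) (Fin m) ℝ}
    (h : ∀ v, M *ᵥ v = 0 → v = 0) : IsUnit M.det := by
  rw [isUnit_iff_ne_zero]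
  intro h0
  obtain ⟨v, hv, hMv⟩ := exists_mulVec_eq_zero_iff.mpr h0
  exact hv (h v hMv)

/-- A kernel vector is an equilibrium for zero input, where the drift bound forces V ≤ 0. -/
theorem isUnit_det_of_lyapunov (hε : 0 < ε) (hQ : Q.PosDef) (hPQ : P * Q = 1)
    (h : ∀ y : Fin m → ℝ, 2 * (y ⬝ᵥ (A *ᵥ (P *ᵥ y))) + 2 * ε * (y ⬝ᵥ (P *ᵥ y))
      + 1 / (2 * ε) * (B ⬝ᵥ y) ^ 2 ≤ 0) : IsUnit A.det := by
  refine isUnit_det_of_forall_mulVec_eq_zero fun v hv => eq_zero_of_quadratic_nonpos hQ ?_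
  have := quadratic_drift_le hε hPQ h 0 v
  simp only [hv, zero_smul, add_zero, zero_dotProduct] at this
  nlinarith

/-- A fixed vector of e^{TA} starts a T-periodic free motion, yet V decays along it by at least the
factor e^{-2εT}. -/
theorem isUnit_det_one_sub_exp (hε : 0 < ε) (hQ : Q.PosDef) (hPQ : P * Q = 1)
    (h : ∀ y : Fin m → ℝ, 2 * (y ⬝ᵥ (A *ᵥ (P *ᵥ y))) + 2 * ε * (y ⬝ᵥ (P *ᵥ y))
      + 1 / (2 * ε) * (B ⬝ᵥ y) ^ 2 ≤ 0) {T : ℝ} (hT : 0 < T) :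
    IsUnit (1 - NormedSpace.exp (T • A)).det := by
  refine isUnit_det_of_forall_mulVec_eq_zero fun v hv => eq_zero_of_quadratic_nonpos hQ ?_
  have hQt : Qᵀ = Q := by simpa using hQ.isHermitian.eq
  have hv' : NormedSpace.exp (T • A) *ᵥ v = v := by
    rw [sub_mulVec, one_mulVec, sub_eq_zero] at hv
    exact hv.symm
  have hanti := antitone_exp_mul_quadratic (u := 0) hε hQt hPQ h
    (z := fun t => NormedSpace.exp (t • A) *ᵥ v)
    (fun t => by simpa using hasDerivAt_exp_smul_mulVec A v t) hT.le
  simp only [hv', mul_zero, zero_smul, NormedSpace.exp_zero, one_mulVec, Real.exp_zero, one_mul,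
    ne_eq, OfNat.ofNat_ne_zero, not_false_eq_true, zero_pow, sub_zero] at hanti
  have h1 : 1 < Real.exp (2 * ε * T) := Real.one_lt_exp_iff.mpr (by positivity)
  by_contra hc
  push Not at hc
  nlinarith

/-- The state at the beginning of a period in the steady response to pulses of width `τ`. -/
noncomputable def pulseStart (A : Matrix (Fin m) (Fin m) ℝ) (w : Fin m → ℝ) (T τ : ℝ) :
    Fin m → ℝ :=
  (1 - NormedSpace.exp (T • A))⁻¹ *ᵥ
    (NormedSpace.exp ((T - τ) • A) *ᵥ (NormedSpace.exp (τ • A) *ᵥ w - w))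

/-- `pulseStart` solves the fixed-point equation of the period map. -/
theorem flow_flow_pulseStart {T : ℝ} (hU : IsUnit (1 - NormedSpace.exp (T • A)).det)
    (w : Fin m → ℝ) (τ : ℝ) :
    flow A w 0 (flow A w 1 (pulseStart A w T τ) τ) (T - τ) = pulseStart A w T τ := by
  have h : (1 - NormedSpace.exp (T • A)) *ᵥ pulseStart A w T τ
      = NormedSpace.exp ((T - τ) • A) *ᵥ (NormedSpace.exp (τ • A) *ᵥ w - w) := by
    rw [pulseStart, mulVec_mulVec, mul_nonsing_inv _ hU, one_mulVec]
  have hT : NormedSpace.exp (T • A)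
      = NormedSpace.exp ((T - τ) • A) * NormedSpace.exp (τ • A) := by
    rw [← exp_add_smul, sub_add_cancel]
  rw [sub_mulVec, one_mulVec, sub_eq_iff_eq_add] at h
  conv_rhs => rw [h]
  simp only [flow, zero_smul, add_zero, sub_zero, one_smul, hT, mulVec_add, mulVec_sub,
    mulVec_mulVec]
  abel

theorem continuous_flow_pulseStart (w : Fin m → ℝ) (T : ℝ) :
    Continuous fun τ => flow A w 1 (pulseStart A w T τ) τ := by
  have h := continuous_exp_smul A
  have h' : Continuous fun τ : ℝ => NormedSpace.exp ((T - τ) • A) :=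
    h.comp (continuous_const.sub continuous_id)
  simp only [flow, pulseStart]
  fun_prop

/-- The extreme widths 0 and T give the equilibria 0 and -w, hence the end values for the
intermediate value theorem. -/
theorem flow_pulseStart_zero (w : Fin m → ℝ) (T : ℝ) :
    flow A w 1 (pulseStart A w T 0) 0 = 0 := by
  simp [flow, pulseStart]

theorem flow_pulseStart_self {T : ℝ} (hU : IsUnit (1 - NormedSpace.exp (T • A)).det)
    (w : Fin m → ℝ) : flow A w 1 (pulseStart A w T T) T = -w := by
  have h : pulseStart A w T T = -w := by
    have hw : NormedSpace.exp (T • A) *ᵥ w - w = (1 - NormedSpace.exp (T • A)) *ᵥ (-w) := by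
      simp [sub_mulVec, mulVec_neg]
    rw [pulseStart, sub_self, zero_smul, NormedSpace.exp_zero, one_mulVec, hw, mulVec_mulVec,
      nonsing_inv_mul _ hU, one_mulVec]
  simp [h, flow]

/-- The steady response to pulses stays, up to centering, in the ellipsoid of radius `1 / 2`. -/
theorem quadratic_flow_pulseStart_le (hε : 0 < ε) (hQ : Qᵀ = Q) (hPQ : P * Q = 1)
    {w : Fin m → ℝ} (hw : A *ᵥ w = B)
    (h : ∀ y : Fin m → ℝ, 2 * (y ⬝ᵥ (A *ᵥ (P *ᵥ y))) + 2 * ε * (y ⬝ᵥ (P *ᵥ y))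
      + 1 / (2 * ε) * (B ⬝ᵥ y) ^ 2 ≤ 0) {T τ : ℝ} (hτ : 0 < τ) (hτT : τ ≤ T)
    (hU : IsUnit (1 - NormedSpace.exp (T • A)).det) {z : ℝ → Fin m → ℝ}
    (hz : z = fun t => flow A w 1 (pulseStart A w T τ) t + (1 / 2 : ℝ) • w) {s : ℝ} (hs : 0 ≤ s) :
    z s ⬝ᵥ (Q *ᵥ z s) ≤ 1 / 4 := by
  have key : ∀ (u : ℝ) (x₀ : Fin m → ℝ), Antitone fun t => Real.exp (2 * ε * t) *
      ((flow A w u x₀ t + (1 / 2 : ℝ) • w) ⬝ᵥ (Q *ᵥ (flow A w u x₀ t + (1 / 2 : ℝ) • w))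
        - (u - 1 / 2) ^ 2) := fun u x₀ =>
    antitone_exp_mul_quadratic hε hQ hPQ h fun t => by
      convert! (hasDerivAt_flow (A := A) w u x₀ t).add_const ((1 / 2 : ℝ) • w) using 1
      simp only [mulVec_add, mulVec_smul, hw, sub_smul]
      abel
  have h1 := key 1 (pulseStart A w T τ) hτ.le
  have h2 := key 0 (flow A w 1 (pulseStart A w T τ) τ) (sub_nonneg.mpr hτT)
  have h3 := key 1 (pulseStart A w T τ) hs
  simp only [flow_flow_pulseStart hU, flow_zero, mul_zero, Real.exp_zero, one_mul] at h1 h2 h3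
  subst hz
  have e1 : 1 < Real.exp (2 * ε * τ) := Real.one_lt_exp_iff.mpr (by positivity)
  have e2 : 1 ≤ Real.exp (2 * ε * (T - τ)) :=
    Real.one_le_exp (mul_nonneg (by positivity) (sub_nonneg.mpr hτT))
  have e3 := Real.exp_pos (2 * ε * s)
  have c1 : ((1 : ℝ) - 1 / 2) ^ 2 = 1 / 4 := by norm_num
  have c2 : ((0 : ℝ) - 1 / 2) ^ 2 = 1 / 4 := by norm_num
  simp only [c1, c2] at h1 h2 h3
  generalize flow A w 1 (pulseStart A w T τ) = y at *
  set V₀ := (pulseStart A w T τ + (1 / 2 : ℝ) • w) ⬝ᵥ (Q *ᵥ (pulseStart A w T τ + (1 / 2 : ℝ) • w))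
  set V₁ := (y τ + (1 / 2 : ℝ) • w) ⬝ᵥ (Q *ᵥ (y τ + (1 / 2 : ℝ) • w))
  -- A positive excess over 1/4 would shrink strictly over a period, contradicting periodicity.
  have h0 : V₀ - 1 / 4 ≤ 0 := by
    by_contra hc
    push Not at hc
    have h4 : V₀ - 1 / 4 ≤ V₁ - 1 / 4 := (le_mul_of_one_le_left hc.le e2).trans h2
    have h5 := lt_mul_of_one_lt_left (hc.trans_le h4) e1
    linarith
  by_contra hc
  push Not at hc
  nlinarith

end Flow

end PWM

namespace PWM

/-! ### From one period to a solution on the half-line. -/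

section PeriodicExtension

open Filter Topology

theorem continuous_comp_toIcoMod {X : Type*} [TopologicalSpace X] {T : ℝ} (hT : 0 < T)
    {g : ℝ → X} (hg : Continuous g) (h : g T = g 0) : Continuous fun t => g (toIcoMod hT 0 t) := by
  have : Fact (0 < T) := ⟨hT⟩
  have h1 : Continuous (AddCircle.liftIco T 0 g) :=
    AddCircle.liftIco_continuous (by rw [zero_add, h]) hg.continuousOn
  have h2 : (fun t => g (toIcoMod hT 0 t)) = fun t : ℝ => AddCircle.liftIco T 0 g (t : AddCircle T) := by
    funext t
    rfl
  rw [h2]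
  exact h1.comp (AddCircle.continuous_mk' T)

theorem toIcoMod_eq_sub {T : ℝ} (hT : 0 < T) (n : ℤ) {t : ℝ} (h₁ : n * T ≤ t)
    (h₂ : t < (n + 1) * T) : toIcoMod hT 0 t = t - n * T := by
  rw [toIcoMod_eq_iff]
  refine ⟨⟨by linarith, by linarith⟩, n, ?_⟩
  rw [zsmul_eq_mul]
  ring

theorem exists_int_mul_le_and_lt {T : ℝ} (hT : 0 < T) (t : ℝ) :
    ∃ n : ℤ, n * T ≤ t ∧ t < (n + 1) * T :=
  ⟨⌊t / T⌋, by rw [← le_div_iff₀ hT]; exact Int.floor_le _,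
    by rw [← div_lt_iff₀ hT]; exact Int.lt_floor_add_one _⟩

variable {m : ℕ} {A : Matrix (Fin m) (Fin m) ℝ} {B C : Fin m → ℝ} {ψ T σ₁ σs τ : ℝ}

/-- The `T`-periodic pulse train of width `τ`. -/
noncomputable def pulseTrain (hT : 0 < T) (τ t : ℝ) : ℝ :=
  if toIcoMod hT 0 t < τ then 1 else 0

theorem pulseTrain_eq_one (hT : 0 < T) (hτT : τ < T) (n : ℤ) {t : ℝ} (h₁ : n * T ≤ t)
    (h₂ : t < n * T + τ) : pulseTrain hT τ t = 1 := by
  rw [pulseTrain, toIcoMod_eq_sub hT n h₁ (by linarith), if_pos (by linarith)]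

theorem pulseTrain_eq_zero (hT : 0 < T) (hτ : 0 < τ) (n : ℤ) {t : ℝ} (h₁ : n * T + τ ≤ t)
    (h₂ : t < (n + 1) * T) : pulseTrain hT τ t = 0 := by
  rw [pulseTrain, toIcoMod_eq_sub hT n (by linarith) h₂, if_neg (by linarith)]

/-- The equation is required wherever the input is continuous, so the switching instants, where the
state may have corners, must be shown to be discontinuities. -/
theorem not_continuousAt_of_eq_on_left {f : ℝ → ℝ} {a t c : ℝ} (hat : a < t)
    (h : ∀ s ∈ Ioo a t, f s = c) (hc : f t ≠ c) : ¬ ContinuousAt f t := fun hf => by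
  have h1 : Tendsto f (𝓝[<] t) (𝓝 (f t)) := hf.tendsto.mono_left nhdsWithin_le_nhds
  have h2 : Tendsto f (𝓝[<] t) (𝓝 c) := tendsto_const_nhds.congr' (by
    filter_upwards [Ioo_mem_nhdsLT hat] with s hs using (h s hs).symm)
  exact hc (tendsto_nhds_unique h1 h2)

theorem not_continuousAt_pulseTrain_start (hT : 0 < T) (hτ : 0 < τ) (hτT : τ < T) (n : ℤ) :
    ¬ ContinuousAt (pulseTrain hT τ) (n * T) := by
  refine not_continuousAt_of_eq_on_left (a := n * T - T + τ) (c := 0) (by linarith)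
    (fun s hs => pulseTrain_eq_zero hT hτ (n - 1) ?_ ?_) ?_
  · push_cast; linarith [hs.1]
  · push_cast; linarith [hs.2]
  · rw [pulseTrain_eq_one hT hτT n le_rfl (by linarith)]
    exact one_ne_zero

theorem not_continuousAt_pulseTrain_end (hT : 0 < T) (hτ : 0 < τ) (hτT : τ < T) (n : ℤ) :
    ¬ ContinuousAt (pulseTrain hT τ) (n * T + τ) := by
  refine not_continuousAt_of_eq_on_left (a := n * T) (c := 1) (by linarith)
    (fun s hs => pulseTrain_eq_one hT hτT n hs.1.le hs.2) ?_
  rw [pulseTrain_eq_zero hT hτ n le_rfl (by linarith)]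
  exact zero_ne_one

/-- Two arcs of trajectories, one per value of the input, that close up over one period and
satisfy the modulation law there extend to an unsaturated periodic mode. -/
theorem exists_isUnsaturatedPeriodicMode_of_arcs (hT : 0 < T) (hτ : 0 < τ) (hτT : τ < T)
    {y z : ℝ → Fin m → ℝ} (hy : ∀ t, HasDerivAt y (A *ᵥ y t + B) t)
    (hz : ∀ t, HasDerivAt z (A *ᵥ z t) t) (hyz : z 0 = y τ) (hzy : z (T - τ) = y 0)
    (hσ : C ⬝ᵥ y τ + ψ = ramp T σ₁ σs τ)
    (hσ' : ∀ s ∈ Ico 0 τ, ramp T σ₁ σs s < C ⬝ᵥ y s + ψ) :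
    ∃ (x : ℝ → Fin m → ℝ) (f : ℝ → ℝ),
      IsUnsaturatedPeriodicMode A B C ψ T σ₁ σs x f := by
  set g : ℝ → Fin m → ℝ := fun t => if t ≤ τ then y t else z (t - τ) with hg
  have hyc : Continuous y := continuous_iff_continuousAt.2 fun t => (hy t).continuousAt
  have hzc : Continuous z := continuous_iff_continuousAt.2 fun t => (hz t).continuousAt
  have hgc : Continuous g := by
    refine Continuous.if_le hyc (by fun_prop) continuous_id continuous_const ?_
    rintro t rfl
    simp [hyz]
  have hg0 : g T = g 0 := by
    simp only [hg, if_neg (not_le.2 hτT), if_pos hτ.le, hzy]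
  have hgτ : ∀ {s}, s ≤ τ → g s = y s := fun hs => if_pos hs
  have hgτ' : ∀ {s}, τ < s → g s = z (s - τ) := fun hs => if_neg (not_le.2 hs)
  have hgn : ∀ (n : ℕ) (s : ℝ), 0 ≤ s → s ≤ T → g (toIcoMod hT 0 (n * T + s)) = g s := by
    intro n s h0 h1
    rcases h1.lt_or_eq with h1 | rfl
    · rw [toIcoMod_eq_sub hT n (by push_cast; linarith) (by push_cast; linarith)]
      push_cast
      congr 1
      ring
    -- The modulation law concerns the closed period; its right end s = T already wraps into period
    -- n + 1.
    · rw [toIcoMod_eq_sub hT (n + 1) (by push_cast; linarith) (by push_cast; linarith), hg0]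
      push_cast
      congr 1
      ring
  refine ⟨fun t => g (toIcoMod hT 0 t), pulseTrain hT τ, ⟨?_, ?_, ?_⟩, ?_, ?_, ?_, ?_⟩
  · exact (continuous_comp_toIcoMod hT hgc hg0).continuousOn
  · intro t _ hf
    obtain ⟨n, hn₁, hn₂⟩ := exists_int_mul_le_and_lt hT t
    have hne₁ : n * T ≠ t := by
      rintro rfl
      exact not_continuousAt_pulseTrain_start hT hτ hτT n hf
    have hne₂ : t ≠ n * T + τ := by
      rintro rfl
      exact not_continuousAt_pulseTrain_end hT hτ hτT n hf
    have hn₁' := lt_of_le_of_ne hn₁ hne₁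
    rcases lt_or_gt_of_ne hne₂ with h | h
    · have hev : (fun t => g (toIcoMod hT 0 t)) =ᶠ[𝓝 t] fun t => y (t - n * T) := by
        filter_upwards [Ioo_mem_nhds hn₁' h] with s hs
        rw [toIcoMod_eq_sub hT n hs.1.le (by linarith [hs.2]), hgτ (by linarith [hs.2])]
      have hd := ((hy (t - n * T)).comp_sub_const t (n * T)).congr_of_eventuallyEq hev
      rw [pulseTrain_eq_one hT hτT n hn₁ h, one_smul, hev.eq_of_nhds]
      exact hd
    · have hev : (fun t => g (toIcoMod hT 0 t)) =ᶠ[𝓝 t] fun t => z (t - (n * T + τ)) := by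
        filter_upwards [Ioo_mem_nhds h hn₂] with s hs
        rw [toIcoMod_eq_sub hT n (by linarith [hs.1]) hs.2, hgτ' (by linarith [hs.1]), sub_sub]
      have hd := ((hz (t - (n * T + τ))).comp_sub_const t (n * T + τ)).congr_of_eventuallyEq hev
      rw [pulseTrain_eq_zero hT hτ n h.le hn₂, zero_smul, add_zero, hev.eq_of_nhds]
      exact hd
  · refine ⟨fun _ => τ, fun n => ⟨Or.inr (Or.inr ⟨?_, ?_, ⟨⟨hτ.le, hτT.le⟩, ?_⟩, ?_⟩), ?_, ?_⟩⟩
    · have h := hσ' 0 ⟨le_rfl, hτ⟩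
      have h0 := hgn n 0 le_rfl hT.le
      rw [add_zero] at h0
      simp only [h0, hgτ hτ.le, not_le]
      simpa [ramp] using h
    · intro h
      have := h τ ⟨hτ.le, hτT.le⟩
      simp only [hgn n τ hτ.le hτT.le, hgτ le_rfl, hσ, lt_irrefl] at this
    · simp only [hgn n τ hτ.le hτT.le, hgτ le_rfl, hσ]
    · rintro s ⟨hs, hse⟩
      by_contra hlt
      push Not at hlt
      simp only [hgn n s hs.1 hs.2, hgτ hlt.le] at hse
      exact (hσ' s ⟨hs.1, hlt⟩).ne' hse
    · exact fun t h₁ h₂ => pulseTrain_eq_one hT hτT n (by simpa using h₁) (by simpa using h₂)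
    · exact fun t h₁ h₂ => pulseTrain_eq_zero hT hτ n (by simpa using h₁) (by simpa using h₂)
  · intro t _
    simp only [toIcoMod_add_right]
  · intro t _
    simp only [pulseTrain, toIcoMod_add_right]
  · intro h
    have := h 0 le_rfl
    rw [pulseTrain_eq_one hT hτT 0 (by simp) (by simpa using hτ)] at this
    exact one_ne_zero this
  · intro h
    have := h τ hτ.le
    rw [pulseTrain_eq_zero hT hτ 0 (by simp) (by simpa using hτT)] at this
    exact zero_ne_one this

end PeriodicExtension

end PWM

/-! ### Choice of the pulse width and first crossing. -/

theorem theorem1 {m : ℕ} (A : Matrix (Fin m) (Fin m) ℝ) (B C : Fin m → ℝ)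
    (ψ T σ₁ σs : ℝ) (hT : 0 < T) (hσ₁ : 0 < σ₁) (hσs : 0 < σs)
    (hA : PWM.IsHurwitz A)
    (hψ₁ : σ₁ < ψ) (hψ₂ : ψ < σ₁ + σs + C ⬝ᵥ (A⁻¹ *ᵥ B))
    (γ : ℝ) (hγ : γ = σs / T - min 0 (C ⬝ᵥ B))
    (hLMI : ∃ ε : ℝ, 0 < ε ∧ ∃ P : Matrix (Fin m) (Fin m) ℝ, P.PosDef ∧
      (-(1 / (2 * ε)) • vecMulVec B B
        - (P * (Aᵀ + ε • (1 : Matrix (Fin m) (Fin m) ℝ))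
          + (A + ε • (1 : Matrix (Fin m) (Fin m) ℝ)) * P)).PosSemidef ∧
      C ⬝ᵥ ((A * P * Aᵀ) *ᵥ C) < γ ^ 2) :
    ∃ (x : ℝ → Fin m → ℝ) (f : ℝ → ℝ),
      PWM.IsUnsaturatedPeriodicMode A B C ψ T σ₁ σs x f := by
  open PWM in
  obtain ⟨ε, hε, P, hP, hL, hCP⟩ := hLMI
  have hPt : Pᵀ = P := by simpa using hP.isHermitian.eq
  have hQ : P⁻¹.PosDef := hP.inv
  have hQt : (P⁻¹)ᵀ = P⁻¹ := by simpa using hQ.isHermitian.eq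
  have hPQ : P * P⁻¹ = 1 := mul_nonsing_inv _ ((isUnit_iff_isUnit_det _).1 hP.isUnit)
  have hq := quadratic_le_of_posSemidef hPt hL
  have hAu : IsUnit A.det := isUnit_det_of_lyapunov hε hQ hPQ hq
  have hU := isUnit_det_one_sub_exp hε hQ hPQ hq hT
  set w := A⁻¹ *ᵥ B
  have hw : A *ᵥ w = B := by rw [mulVec_mulVec, mul_nonsing_inv _ hAu, one_mulVec]
  have hd : (Aᵀ *ᵥ C) ⬝ᵥ (P *ᵥ (Aᵀ *ᵥ C)) < γ ^ 2 := by
    rwa [mulVec_transpose, ← dotProduct_mulVec, ← mulVec_transpose, mulVec_mulVec,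
      mulVec_mulVec]
  have hdA : ∀ v, (Aᵀ *ᵥ C) ⬝ᵥ v = C ⬝ᵥ (A *ᵥ v) := fun v => by
    rw [mulVec_transpose, ← dotProduct_mulVec]
  have hγ0 : 0 < γ := by
    have := div_pos hσs hT
    linarith [min_le_left 0 (C ⬝ᵥ B)]
  have hbound : ∀ (r : ℝ) (v : Fin m → ℝ), 0 < r → v ⬝ᵥ (P⁻¹ *ᵥ v) ≤ r ^ 2 →
      C ⬝ᵥ (A *ᵥ v) < r * γ := by
    intro r v hr hv
    have h := sq_dotProduct_le hP hPQ (Aᵀ *ᵥ C) v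
    have h0 : 0 ≤ (Aᵀ *ᵥ C) ⬝ᵥ (P *ᵥ (Aᵀ *ᵥ C)) := by
      simpa using hP.posSemidef.dotProduct_mulVec_nonneg (Aᵀ *ᵥ C)
    rw [hdA] at h
    refine lt_of_pow_lt_pow_left₀ 2 (by positivity) (h.trans_lt ?_)
    calc _ ≤ _ * r ^ 2 := mul_le_mul_of_nonneg_left hv h0
      _ < γ ^ 2 * r ^ 2 := by gcongr
      _ = (r * γ) ^ 2 := by ring
  -- For input -1 the point w is an equilibrium, so V(w) ≤ 1.
  have hCB : C ⬝ᵥ B < γ := by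
    have h := quadratic_drift_le hε hPQ hq (-1) w
    rw [hw, neg_one_smul, add_neg_cancel, zero_dotProduct] at h
    have := hbound 1 w one_pos (by nlinarith)
    rwa [hw, one_mul] at this
  -- The minimum in γ serves the case CB ≤ 0; for CB ≥ 0, γ = σs/T and `hCB` suffices.
  have hslope : C ⬝ᵥ B / 2 + γ / 2 ≤ σs / T := by
    have := div_pos hσs hT
    rcases le_total 0 (C ⬝ᵥ B) with h | h
    · rw [min_eq_left h] at hγ
      linarith
    · rw [min_eq_right h] at hγ
      linarith
  set G : ℝ → ℝ := fun τ => C ⬝ᵥ flow A w 1 (pulseStart A w T τ) τ + ψ - ramp T σ₁ σs τ with hG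
  have hGc : Continuous G := by
    have := continuous_flow_pulseStart (A := A) w T
    simp only [hG, ramp]
    fun_prop
  have hG0 : 0 < G 0 := by
    simp only [hG, flow_pulseStart_zero, ramp, dotProduct_zero]
    simpa using hψ₁
  have hGT : G T < 0 := by
    simp only [hG, flow_pulseStart_self hU, ramp, dotProduct_neg, mul_div_cancel_right₀ _ hT.ne']
    linarith
  obtain ⟨τ, ⟨hτ0, hτT⟩, hGτ⟩ := intermediate_value_Icc' hT.le hGc.continuousOn ⟨hGT.le, hG0.le⟩
  have hτ : 0 < τ := lt_of_le_of_ne hτ0 (by rintro rfl; exact hG0.ne' hGτ)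
  have hτT' : τ < T := lt_of_le_of_ne hτT (by rintro rfl; exact hGT.ne hGτ)
  set y := flow A w 1 (pulseStart A w T τ) with hy
  have hyd : ∀ t, HasDerivAt y (A *ᵥ y t + B) t := fun t => by
    simpa only [one_smul, hw] using hasDerivAt_flow (A := A) w 1 (pulseStart A w T τ) t
  have hhd : ∀ t, HasDerivAt (fun t => C ⬝ᵥ y t + ψ - ramp T σ₁ σs t)
      (C ⬝ᵥ (A *ᵥ y t + B) - σs / T) t := fun t => by
    have h1 : HasDerivAt (fun t => C ⬝ᵥ y t) (C ⬝ᵥ (A *ᵥ y t + B)) t :=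
      HasDerivAt.fun_sum fun i _ => (hasDerivAt_pi.mp (hyd t) i).const_mul (C i)
    have h2 : HasDerivAt (ramp T σ₁ σs) (σs / T) t := by
      have := (((hasDerivAt_id t).const_mul σs).div_const T).const_add σ₁
      rwa [mul_one] at this
    exact (h1.add_const ψ).sub h2
  have hanti : StrictAntiOn (fun t => C ⬝ᵥ y t + ψ - ramp T σ₁ σs t) (Icc 0 τ) := by
    refine strictAntiOn_of_deriv_neg (convex_Icc 0 τ)
      (fun t _ => (hhd t).continuousAt.continuousWithinAt) fun t ht => ?_
    rw [interior_Icc] at ht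
    rw [(hhd t).deriv]
    have h := quadratic_flow_pulseStart_le hε hQt hPQ hw hq hτ hτT hU rfl ht.1.le
    have h' := hbound (1 / 2) _ (by norm_num) (h.trans_eq (by norm_num))
    simp only [mulVec_add, mulVec_smul, hw, dotProduct_add, dotProduct_smul, smul_eq_mul] at h'
    -- The slope of σ is C(Ay + B) = CAz + CB/2, with CAz < γ/2 by `h'`.
    rw [dotProduct_add, hy]
    linarith
  have hyτ : C ⬝ᵥ y τ + ψ - ramp T σ₁ σs τ = 0 := hGτ
  refine exists_isUnsaturatedPeriodicMode_of_arcs hT hτ hτT' hyd (z := flow A w 0 (y τ))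
    (fun t => by simpa only [zero_smul, add_zero] using hasDerivAt_flow (A := A) w 0 (y τ) t)
    (flow_zero w 0 _) ?_ (sub_eq_zero.mp hyτ) fun s hs => ?_
  · rw [hy, flow_flow_pulseStart hU, flow_zero]
  · have := hanti ⟨hs.1, hs.2.le⟩ ⟨hτ.le, le_rfl⟩ hs.2
    simp only [hyτ] at this
    linarith
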